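/- Fix a countably infinite set $\mathcal V$ of names. Let $\mathfrak S(\mathcal V)$ be the group of permutations of $\mathcal V$ generated by transpositions, and let $\mathsf{Nom}$ be the category of nominal sets ($\mathfrak S(\mathcal V)$-sets all of whose elements are finitely supported) and equivariant maps, with forgetful functor $U:\mathsf{Nom}\to\mathsf{Set}$ and terminal object $1$. Write $\mathrm{supp}(u)$ for the least finite support of $u$. For a nominal set $X$, the abstraction $[\mathcal V]X$ is the quotient of $\mathcal V\times X$ by the relation $(x_1,u_1)\sim(x_2,u_2)$ iff $(x_1\,z)\cdot u_1=(x_2\,z)\cdot u_2$ for some $z$ fresh for $x_1,u_1,x_2,u_2$; let $\theta_X:\mathcal V\times X\to[\mathcal V]X$ be the quotient map. Let $(\Sigma,\mathsf{ar})$ be a binding signature, i.e. a set $\Sigma$ with a map $\mathsf{ar}:\Sigma\to\mathbb N^*$ into finite lists of natural numbers, and let $F,F_\alpha:\mathsf{Nom}\to\mathsf{Nom}$ be the functors $$F X=\mathcal V+\coprod_{\mathsf{op}\in\Sigma,\ \mathsf{ar}(\mathsf{op})=n_1,\dots,n_k}(\mathcal V^{n_1}\times X)\times\dots\times(\mathcal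 V^{n_k}\times X),\qquad F_\alpha X=\mathcal V+\coprod_{\mathsf{op}\in\Sigma,\ \mathsf{ar}(\mathsf{op})=n_1,\dots,n_k}[\mathcal V]^{n_1}X\times\dots\times[\mathcal V]^{n_k}X .$$ Let $q:F\to F_\alpha$ be the natural transformation obtained, through products and coproducts, from the maps $q^{(n)}_X:\mathcal V^n\times X\to[\mathcal V]^nX$ with $q^{(0)}=\mathrm{id}$ and $q^{(n+1)}=\theta\circ(\mathcal V\times q^{(n)})$. Let $a_n:F^n1\to F_\alpha^n1$ be given by $a_0=\mathrm{id}_1$ and $a_{n+1}=q_{F_\alpha^n1}\circ F(a_n)$. Together with the maps $F^n!:F^{n+1}1\to F^n1$ and $F_\alpha^n!:F_\alpha^{n+1}1\to F_\alpha^n1$, where $!$ denotes the maps to $1$, they form commutative squares $a_n\circ F^n!=F_\alpha^n!\circ a_{n+1}$, and so induce a map $a:\lim_n UF^n1\to\lim_n UF_\alpha^n1$ between the limits in $\mathsf{Set}$. For an equivariant map $f:X\to Y$, an element $u\in X$ is $f$-safe if $|\mathrm{supp}(u)|=\max\{|\mathrm{supp}(v)| : v\in X,\ f(v)=f(u)\}$;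 the map $f$ is safe if every $v\in Y$ is the image of an $f$-safe element. A commutative square $f\circ p=q'\circ g$ of equivariant maps $p:Z\to X$, $f:X\to W$, $g:Z\to Y$, $q':Y\to W$ is safe if, for every $f$-safe $u\in X$ and every $v\in Y$ with $f(u)=q'(v)$ and $(\mathrm{supp}(u)\setminus\mathrm{supp}(f(u)))\cap\mathrm{supp}(v)=\emptyset$, there is a $g$-safe $z\in Z$ with $p(z)=u$ and $g(z)=v$. Theorem. (1) For every $n\ge 0$ the map $a_n:F^n1\to F_\alpha^n1$ is safe. (2) For every $n\ge0$ the square with top $F^n!:F^{n+1}1\to F^n1$, left side $a_n$, right side $a_{n+1}$ and bottom $F_\alpha^n!:F_\alpha^{n+1}1\to F_\alpha^n1$ is safe. (3) Let $\mathsf T_\alpha$ be the final $F_\alpha$-coalgebra, let $\iota_\alpha:U\mathsf T_\alpha\to\lim_n UF_\alpha^n1$ be the map induced by its canonical cone over the sequence $(F_\alpha^n1)_n$, and let $P$ be the pullback in $\mathsf{Set}$ of $a$ and $\iota_\alpha$, that is, $P=\{(s,t)\in \lim_n UF^n1\times U\mathsf T_\alpha : a(s)=\iota_\alpha(t)\}$.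 Then the projection $P\to U\mathsf T_\alpha$ is onto. -/

import Mathlib

open CategoryTheory

universe u

namespace Nominal

/-! ### Nominal sets -/

/-- The group of permutations of the set of names `V` generated by transpositions. -/
abbrev FinPerm (V : Type u) [DecidableEq V] : Type u :=
  Subgroup.closure {σ : Equiv.Perm V | σ.IsSwap}

/-- The transposition `(a b)` (the identity if `a = b`). -/
def transp {V : Type u} [DecidableEq V] (a b : V) : FinPerm V :=
  ⟨Equiv.swap a b, by
    by_cases h : a = b
    · subst h
      rw [Equiv.swap_self]
      exact Subgroup.one_mem _
    · exact Subgroup.subset_closure ⟨a, b, h, rfl⟩⟩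

/-- A nominal set over the set of names `V`: a set with an action of `FinPerm V` all of whose
elements are finitely supported. -/
structure Nom (V : Type u) [DecidableEq V] where
  /-- the underlying set -/
  carrier : Type u
  /-- the action -/
  [action : MulAction (FinPerm V) carrier]
  /-- every element is finitely supported -/
  finitely_supported :
    ∀ x : carrier, ∃ S : Finset V, MulAction.Supports (FinPerm V) (S : Set V) x

instance (V : Type u) [DecidableEq V] : CoeSort (Nom V) (Type u) := ⟨Nom.carrier⟩

attribute [instance] Nom.action

/-- Equivariant maps. -/
@[ext]
structure Nom.Hom {V : Type u} [DecidableEq V] (X Y : Nom V) where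
  /-- the underlying function -/
  toFun : X → Y
  equivariant : ∀ (π : FinPerm V) (x : X), toFun (π • x) = π • toFun x

/-- The category of nominal sets and equivariant maps. -/
instance (V : Type u) [DecidableEq V] : Category (Nom V) where
  Hom X Y := Nom.Hom X Y
  id X := ⟨fun x => x, fun _ _ => rfl⟩
  comp f g := ⟨fun x => g.toFun (f.toFun x), fun π x => by rw [f.equivariant, g.equivariant]⟩

section Supp

variable {V : Type u} [DecidableEq V]

@[ext]
theorem hom_ext {X Y : Nom V} {f g : X ⟶ Y} (h : ∀ x, f.toFun x = g.toFun x) : f = g :=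
  Nom.Hom.ext (funext h)

@[simp]
theorem id_toFun (X : Nom V) (x : X) : (𝟙 X : X ⟶ X).toFun x = x := rfl

@[simp]
theorem comp_toFun {X Y Z : Nom V} (f : X ⟶ Y) (g : Y ⟶ Z) (x : X) :
    (f ≫ g).toFun x = g.toFun (f.toFun x) := rfl

/-- The support of an element: its least finite support, that is, the intersection of all finite
sets that support it (see `supports_supp`). -/
def supp {X : Nom V} (x : X) : Set V :=
  {a | ∀ S : Finset V, MulAction.Supports (FinPerm V) (S : Set V) x → a ∈ S}

theorem supp_subset {X : Nom V} {x : X} {S : Finset V}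
    (h : MulAction.Supports (FinPerm V) (S : Set V) x) : supp x ⊆ S :=
  fun _ ha => ha S h

theorem supp_finite {X : Nom V} (x : X) : (supp x).Finite :=
  let ⟨S, hS⟩ := X.finitely_supported x
  S.finite_toSet.subset (supp_subset hS)

theorem transp_smul_eq {X : Nom V} {x : X} {S : Finset V}
    (h : MulAction.Supports (FinPerm V) (S : Set V) x) {a b : V} (ha : a ∉ S) (hb : b ∉ S) :
    transp a b • x = x :=
  h _ fun _ hc => Equiv.swap_apply_of_ne_of_ne
    (fun e => ha (e ▸ hc)) (fun e => hb (e ▸ hc))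

theorem transp_conj (π : FinPerm V) (a b : V) :
    π * transp a b = transp (π • a) (π • b) * π :=
  Subtype.ext (Equiv.mul_swap_eq_swap_mul π.1 a b)

theorem transp_three {a b c : V} (hb : a ≠ b) (hc : a ≠ c) :
    transp b c * transp a b = transp a c * transp b c := by
  rw [transp_conj (transp b c) a b]
  congr 2
  · exact Equiv.swap_apply_of_ne_of_ne hb hc
  · exact Equiv.swap_apply_left b c

theorem smul_eq_of_transp {X : Nom V} {x : X} (M : Finset V)
    (hM : ∀ a ∈ M, ∀ b ∈ M, transp a b • x = x) :
    ∀ π : FinPerm V, (∀ a, a ∉ M → π • a = a) → π • x = x := by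
  induction M using Finset.induction_on with
  | empty =>
    intro π h
    have : π = 1 := Subtype.ext (Equiv.ext fun a => h a (by simp))
    rw [this, one_smul]
  | insert a M _ ih =>
    intro π h
    have ha : π • a ∈ insert a M := by
      by_contra hc
      have h2 : π • (π • a) = π • a := h _ hc
      have h3 : π • a = a := smul_left_cancel π h2
      rw [h3] at hc
      exact hc (Finset.mem_insert_self a M)
    have h1 := ih (fun b hb c hc => hM b (Finset.mem_insert_of_mem hb) c
      (Finset.mem_insert_of_mem hc)) (transp a (π • a) * π) (by
        intro b hb
        rw [mul_smul]
        by_cases hba : b = a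
        · subst hba
          exact Equiv.swap_apply_right _ _
        · have hb' : π • b = b := h b (by simp [hba, hb])
          rw [hb']
          refine Equiv.swap_apply_of_ne_of_ne hba fun e => hba ?_
          exact smul_left_cancel π (hb'.trans e))
    rw [mul_smul] at h1
    have h2 := hM a (Finset.mem_insert_self a M) _ ha
    exact smul_left_cancel (transp a (π • a)) (h1.trans h2.symm)

theorem transp_smul_of_notMem_supp [Infinite V] {X : Nom V} {x : X} {a b : V}
    (ha : a ∉ supp x) (hb : b ∉ supp x) : transp a b • x = x := by
  simp only [supp, Set.mem_ofPred_eq, not_forall] at ha hb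
  obtain ⟨S, hS, haS⟩ := ha
  obtain ⟨T, hT, hbT⟩ := hb
  obtain ⟨c, hc⟩ := Infinite.exists_notMem_finset (S ∪ T ∪ {a, b})
  simp only [Finset.mem_union, Finset.mem_insert, Finset.mem_singleton, not_or] at hc
  obtain ⟨⟨hcS, hcT⟩, hca, hcb⟩ := hc
  have h1 : transp a c • x = x := transp_smul_eq hS haS hcS
  have h2 : transp c b • x = x := transp_smul_eq hT hcT hbT
  by_cases hab : a = b
  · subst hab
    have : transp a a = (1 : FinPerm V) := Subtype.ext (Equiv.swap_self a)
    rw [this, one_smul]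
  · have h3 := congrArg (fun σ : FinPerm V => σ • x)
      (transp_three (a := a) (b := c) (c := b) (Ne.symm hca) hab)
    simp only [mul_smul, h1, h2] at h3
    exact h3.symm

/-- The support supports. -/
theorem supports_supp [Infinite V] {X : Nom V} (x : X) :
    MulAction.Supports (FinPerm V) (supp x) x := by
  intro π hπ
  have hfin : {a : V | π • a ≠ a}.Finite := mem_closure_isSwap'.1 π.2
  refine smul_eq_of_transp hfin.toFinset (fun a ha b hb => transp_smul_of_notMem_supp ?_ ?_) π ?_
  · exact fun h => (hfin.mem_toFinset.1 ha) (hπ h)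
  · exact fun h => (hfin.mem_toFinset.1 hb) (hπ h)
  · intro a ha
    by_contra hc
    exact ha (hfin.mem_toFinset.2 hc)

theorem mem_supp_of_smul {X : Nom V} {x : X} {π : FinPerm V} {a : V}
    (h : π • a ∈ supp (π • x)) : a ∈ supp x := by
  intro S hS
  have h1 := h (S.image (π • ·)) (by
    intro σ hσ
    have h2 : (π⁻¹ * σ * π) • x = x := hS _ fun b hb => by
      have : σ • (π • b) = π • b := hσ (Finset.mem_coe.2 (Finset.mem_image_of_mem _ hb))
      rw [mul_smul, mul_smul, this, inv_smul_smul]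
    rw [mul_smul, mul_smul, inv_smul_eq_iff] at h2
    exact h2)
  obtain ⟨b, hb, hba⟩ := Finset.mem_image.1 h1
  exact smul_left_cancel π hba ▸ hb

theorem smul_notMem_supp {X : Nom V} {x : X} {π : FinPerm V} {a : V}
    (h : a ∉ supp x) : π • a ∉ supp (π • x) :=
  fun h' => h (mem_supp_of_smul h')

end Supp

/-! ### Constructions on nominal sets -/

section Constructions

variable (V : Type u) [DecidableEq V]

/-- The nominal set of names. -/
def names : Nom V where
  carrier := V
  finitely_supported x := ⟨{x}, fun _ h => h (by simp)⟩

/-- The terminal nominal set `1`. -/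
def one : Nom V where
  carrier := PUnit
  action :=
    { smul := fun _ x => x
      one_smul := fun _ => rfl
      mul_smul := fun _ _ _ => rfl }
  finitely_supported _ := ⟨∅, fun _ _ => rfl⟩

variable {V}

/-- The unique map to `1`. -/
def toOne (X : Nom V) : X ⟶ one V :=
  ⟨fun _ => PUnit.unit, fun _ _ => rfl⟩

/-- Binary products. -/
def prod (X Y : Nom V) : Nom V where
  carrier := X × Y
  finitely_supported p := by
    obtain ⟨S, hS⟩ := X.finitely_supported p.1
    obtain ⟨T, hT⟩ := Y.finitely_supported p.2
    refine ⟨S ∪ T, fun π h => Prod.ext (hS π fun a ha => h ?_) (hT π fun a ha => h ?_)⟩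
    · exact Finset.mem_coe.2 (Finset.mem_union_left T ha)
    · exact Finset.mem_coe.2 (Finset.mem_union_right S ha)

/-- Binary coproducts. -/
def sum (X Y : Nom V) : Nom V where
  carrier := X ⊕ Y
  finitely_supported
    | Sum.inl x =>
      let ⟨S, hS⟩ := X.finitely_supported x
      ⟨S, fun π h => congrArg Sum.inl (hS π h)⟩
    | Sum.inr y =>
      let ⟨S, hS⟩ := Y.finitely_supported y
      ⟨S, fun π h => congrArg Sum.inr (hS π h)⟩

/-- Arbitrary coproducts. -/
def sigma {I : Type u} (X : I → Nom V) : Nom V where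
  carrier := Σ i, X i
  finitely_supported := fun ⟨i, x⟩ =>
    let ⟨S, hS⟩ := (X i).finitely_supported x
    ⟨S, fun π h => congrArg (Sigma.mk i) (hS π h)⟩

/-- The relation `(x₁, u₁) ∼ (x₂, u₂)` on `V × X`: for some `z` fresh for `x₁, u₁, x₂, u₂`
one has `(x₁ z) • u₁ = (x₂ z) • u₂`. -/
def AbsRel (X : Nom V) (p q : V × X) : Prop :=
  ∃ z : V, (z ≠ p.1 ∧ z ∉ supp p.2 ∧ z ≠ q.1 ∧ z ∉ supp q.2) ∧
    transp p.1 z • p.2 = transp q.1 z • q.2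

theorem AbsRel.smul {X : Nom V} {p q : V × X} (h : AbsRel X p q) (π : FinPerm V) :
    AbsRel X (π • p.1, π • p.2) (π • q.1, π • q.2) := by
  obtain ⟨z, ⟨h1, h2, h3, h4⟩, h⟩ := h
  refine ⟨π • z, ⟨fun e => h1 (smul_left_cancel π e), smul_notMem_supp h2,
    fun e => h3 (smul_left_cancel π e), smul_notMem_supp h4⟩, ?_⟩
  simp only
  rw [← mul_smul, ← mul_smul, ← transp_conj, ← transp_conj, mul_smul, mul_smul, h]

theorem AbsRel.map {X Y : Nom V} (f : X ⟶ Y) {p q : V × X} (h : AbsRel X p q) :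
    AbsRel Y (p.1, f.toFun p.2) (q.1, f.toFun q.2) := by
  have hs : ∀ x : X, supp (f.toFun x) ⊆ supp x := fun x a ha S hS =>
    ha S fun π hπ => by rw [← f.equivariant, hS π hπ]
  obtain ⟨z, ⟨h1, h2, h3, h4⟩, h⟩ := h
  refine ⟨z, ⟨h1, fun hz => h2 (hs _ hz), h3, fun hz => h4 (hs _ hz)⟩, ?_⟩
  simp only
  rw [← f.equivariant, ← f.equivariant, h]

theorem transp_smul_fresh [Infinite V] {X : Nom V} {a z c : V} {u : X} (hza : z ≠ a)
    (hca : c ≠ a) (hz : z ∉ supp u) (hc : c ∉ supp u) :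
    transp a c • u = transp z c • transp a z • u := by
  rw [← mul_smul, transp_three hza.symm hca.symm, mul_smul, transp_smul_of_notMem_supp hz hc]

theorem absRel_equivalence [Infinite V] (X : Nom V) : Equivalence (AbsRel X) where
  refl p := by
    obtain ⟨z, hz⟩ := ((supp_finite p.2).union (Set.finite_singleton p.1)).exists_notMem
    simp only [Set.mem_union, Set.mem_singleton_iff, not_or] at hz
    exact ⟨z, ⟨hz.2, hz.1, hz.2, hz.1⟩, rfl⟩
  symm := fun ⟨z, ⟨h1, h2, h3, h4⟩, h⟩ => ⟨z, ⟨h3, h4, h1, h2⟩, h.symm⟩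
  trans := by
    rintro p q r ⟨z, ⟨h1, h2, h3, h4⟩, h⟩ ⟨w, ⟨k1, k2, k3, k4⟩, k⟩
    obtain ⟨c, hc⟩ := (((supp_finite p.2).union ((supp_finite q.2).union (supp_finite r.2))).union
      (Set.toFinite {p.1, q.1, r.1})).exists_notMem
    simp only [Set.mem_union, Set.mem_insert_iff, Set.mem_singleton_iff, not_or] at hc
    obtain ⟨⟨c1, c2, c3⟩, d1, d2, d3⟩ := hc
    refine ⟨c, ⟨d1, c1, d3, c3⟩, ?_⟩
    rw [transp_smul_fresh h1 d1 h2 c1, h, ← transp_smul_fresh h3 d2 h4 c2,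
      transp_smul_fresh k1 d2 k2 c2, k, ← transp_smul_fresh k3 d3 k4 c3]

variable [Infinite V]

/-- The setoid of `AbsRel`. -/
def absSetoid (X : Nom V) : Setoid (V × X) := ⟨AbsRel X, absRel_equivalence X⟩

/-- The abstraction `[V]X`, with action `π • ⟨x⟩u = ⟨π • x⟩(π • u)`. -/
def abs (X : Nom V) : Nom V where
  carrier := Quotient (absSetoid X)
  action :=
    { smul := fun π => Quotient.map (fun p => (π • p.1, π • p.2)) fun _ _ h => AbsRel.smul h π
      one_smul := by
        rintro ⟨p⟩
        exact congrArg (Quotient.mk (absSetoid X)) (Prod.ext (one_smul _ p.1) (one_smul _ p.2))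
      mul_smul := by
        rintro π σ ⟨p⟩
        exact congrArg (Quotient.mk (absSetoid X))
          (Prod.ext (mul_smul π σ p.1) (mul_smul π σ p.2)) }
  finitely_supported := by
    rintro ⟨p⟩
    obtain ⟨S, hS⟩ := X.finitely_supported p.2
    refine ⟨insert p.1 S, fun π h => congrArg (Quotient.mk (absSetoid X))
      (Prod.ext (h (by simp)) (hS π fun a ha => h ?_))⟩
    exact Finset.mem_coe.2 (Finset.mem_insert_of_mem ha)

/-- The abstraction functor `[V](-)`, with `([V]f)(⟨x⟩u) = ⟨x⟩f(u)`. -/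
def absFunctor : Nom V ⥤ Nom V where
  obj := abs
  map {X Y} f := ⟨Quotient.map (fun p => (p.1, f.toFun p.2)) fun _ _ h => AbsRel.map f h, by
    rintro π ⟨p⟩
    exact congrArg (Quotient.mk (absSetoid Y)) (Prod.ext rfl (f.equivariant π p.2))⟩
  map_id X := hom_ext (by rintro ⟨p⟩; rfl)
  map_comp f g := hom_ext (by rintro ⟨p⟩; rfl)


end Constructions

/-! ### The functors of a binding signature -/

section Functors

variable {V : Type u} [DecidableEq V]

/-- The functor `V × -`. -/
def namesProd : Nom V ⥤ Nom V where
  obj X := prod (names V) X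
  map f := ⟨fun p => (p.1, f.toFun p.2), fun π p => Prod.ext rfl (f.equivariant π p.2)⟩

/-- The constant functor. -/
def constFunctor (K : Nom V) : Nom V ⥤ Nom V where
  obj _ := K
  map _ := 𝟙 K

/-- The pointwise product of two functors. -/
def prodFunctor (G H : Nom V ⥤ Nom V) : Nom V ⥤ Nom V where
  obj X := prod (G.obj X) (H.obj X)
  map f := ⟨fun p => ((G.map f).toFun p.1, (H.map f).toFun p.2), fun π p =>
    Prod.ext ((G.map f).equivariant π p.1) ((H.map f).equivariant π p.2)⟩
  map_id X := hom_ext fun p => Prod.ext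
    (congrArg (fun h => h.toFun p.1) (G.map_id X)) (congrArg (fun h => h.toFun p.2) (H.map_id X))
  map_comp f g := hom_ext fun p => Prod.ext
    (congrArg (fun h => h.toFun p.1) (G.map_comp f g))
    (congrArg (fun h => h.toFun p.2) (H.map_comp f g))

/-- The pointwise coproduct of two functors. -/
def sumFunctor (G H : Nom V ⥤ Nom V) : Nom V ⥤ Nom V where
  obj X := sum (G.obj X) (H.obj X)
  map f := ⟨Sum.map (G.map f).toFun (H.map f).toFun, by
    rintro π (x | y)
    · exact congrArg Sum.inl ((G.map f).equivariant π x)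
    · exact congrArg Sum.inr ((H.map f).equivariant π y)⟩
  map_id X := hom_ext (by
    rintro (x | y)
    · exact congrArg (fun h => Sum.inl (h.toFun x)) (G.map_id X)
    · exact congrArg (fun h => Sum.inr (h.toFun y)) (H.map_id X))
  map_comp f g := hom_ext (by
    rintro (x | y)
    · exact congrArg (fun h => Sum.inl (h.toFun x)) (G.map_comp f g)
    · exact congrArg (fun h => Sum.inr (h.toFun y)) (H.map_comp f g))

/-- The pointwise coproduct of a family of functors. -/
def sigmaFunctor {I : Type u} (G : I → (Nom V ⥤ Nom V)) : Nom V ⥤ Nom V where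
  obj X := sigma fun i => (G i).obj X
  map f := ⟨fun p => ⟨p.1, ((G p.1).map f).toFun p.2⟩, fun π p =>
    congrArg (Sigma.mk p.1) (((G p.1).map f).equivariant π p.2)⟩
  map_id X := hom_ext fun ⟨i, x⟩ =>
    congrArg (Sigma.mk i) (congrArg (fun h => h.toFun x) ((G i).map_id X))
  map_comp f g := hom_ext fun ⟨i, x⟩ =>
    congrArg (Sigma.mk i) (congrArg (fun h => h.toFun x) ((G i).map_comp f g))

/-- The product `q' × q''` of natural transformations. -/
def prodNat {G G' H H' : Nom V ⥤ Nom V} (q' : G ⟶ G') (q'' : H ⟶ H') :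
    prodFunctor G H ⟶ prodFunctor G' H' where
  app X := ⟨fun p => ((q'.app X).toFun p.1, (q''.app X).toFun p.2), fun π p =>
    Prod.ext ((q'.app X).equivariant π p.1) ((q''.app X).equivariant π p.2)⟩
  naturality _ _ f := hom_ext fun p => Prod.ext
    (congrArg (fun h => h.toFun p.1) (q'.naturality f))
    (congrArg (fun h => h.toFun p.2) (q''.naturality f))

/-- The coproduct `q' + q''` of natural transformations. -/
def sumNat {G G' H H' : Nom V ⥤ Nom V} (q' : G ⟶ G') (q'' : H ⟶ H') :
    sumFunctor G H ⟶ sumFunctor G' H' where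
  app X := ⟨Sum.map (q'.app X).toFun (q''.app X).toFun, by
    rintro π (x | y)
    · exact congrArg Sum.inl ((q'.app X).equivariant π x)
    · exact congrArg Sum.inr ((q''.app X).equivariant π y)⟩
  naturality _ _ f := hom_ext (by
    rintro (x | y)
    · exact congrArg (fun h => Sum.inl (h.toFun x)) (q'.naturality f)
    · exact congrArg (fun h => Sum.inr (h.toFun y)) (q''.naturality f))

/-- The coproduct of a family of natural transformations. -/
def sigmaNat {I : Type u} {G H : I → (Nom V ⥤ Nom V)} (q : ∀ i, G i ⟶ H i) :
    sigmaFunctor G ⟶ sigmaFunctor H where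
  app X :=
    { toFun := fun (p : Σ i, (G i).obj X) =>
        (⟨p.1, ((q p.1).app X).toFun p.2⟩ : Σ i, (H i).obj X)
      equivariant := fun π (p : Σ i, (G i).obj X) =>
        congrArg (Sigma.mk p.1) (((q p.1).app X).equivariant π p.2) }
  naturality _ Y f := hom_ext fun (⟨i, x⟩ : Sigma _) =>
    congrArg (Sigma.mk (β := fun i => (H i).obj Y) i)
      (congrArg (fun h => h.toFun x) ((q i).naturality f))

/-- The natural transformation `θ : V × - ⟶ [V](-)`, `(x, u) ↦ ⟨x⟩u`. -/
def theta [Infinite V] : (namesProd : Nom V ⥤ Nom V) ⟶ absFunctor where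
  app X := ⟨fun p => Quotient.mk (absSetoid X) p, fun _ _ => rfl⟩

/-- `namesPow n` is `X ↦ Vⁿ × X`, the `n`-fold iterate of `V × -`. -/
def namesPow : ℕ → (Nom V ⥤ Nom V)
  | 0 => 𝟭 (Nom V)
  | n + 1 => namesPow n ⋙ namesProd

/-- `absPow n` is `X ↦ [V]ⁿX`, the `n`-fold iterate of abstraction. -/
def absPow [Infinite V] : ℕ → (Nom V ⥤ Nom V)
  | 0 => 𝟭 (Nom V)
  | n + 1 => absPow n ⋙ absFunctor

/-- The natural transformation `Vⁿ × X ⟶ [V]ⁿX`: the identity for `n = 0`, and `θ ∘ (V × q')`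
for `n + 1`, where `q'` is the transformation for `n`. -/
def powNat [Infinite V] : ∀ n : ℕ, (namesPow n : Nom V ⥤ Nom V) ⟶ absPow n
  | 0 => 𝟙 (𝟭 (Nom V))
  | n + 1 => Functor.whiskerRight (powNat n) namesProd ≫ Functor.whiskerLeft (absPow n) theta

/-- `listProd G [n₁, …, n_k]` is `X ↦ G n₁ X × ⋯ × G n_k X` (and `1` for `k = 0`). -/
def listProd (G : ℕ → (Nom V ⥤ Nom V)) : List ℕ → (Nom V ⥤ Nom V)
  | [] => constFunctor (one V)
  | n :: l => prodFunctor (G n) (listProd G l)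

/-- The product of natural transformations `G nᵢ ⟶ H nᵢ`. -/
def listProdNat {G H : ℕ → (Nom V ⥤ Nom V)} (q : ∀ n, G n ⟶ H n) :
    ∀ l : List ℕ, listProd G l ⟶ listProd H l
  | [] => 𝟙 (constFunctor (one V))
  | n :: l => prodNat (q n) (listProdNat q l)

end Functors

/-- A binding signature: a set of operations with binding arities, which are finite lists of
natural numbers. -/
structure BindingSignature where
  /-- the operations -/
  Op : Type u
  /-- the binding arities -/
  ar : Op → List ℕ

section Signature

variable (V : Type u) [DecidableEq V] [Infinite V] (B : BindingSignature.{u})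

/-- `F X = V + ∐_{op, ar(op) = n₁,…,n_k} (V^{n₁} × X) × ⋯ × (V^{n_k} × X)`. -/
def rawFunctor : Nom V ⥤ Nom V :=
  sumFunctor (constFunctor (names V)) (sigmaFunctor fun o : B.Op => listProd namesPow (B.ar o))

/-- `F_α X = V + ∐_{op, ar(op) = n₁,…,n_k} [V]^{n₁}X × ⋯ × [V]^{n_k}X`. -/
def alphaFunctor : Nom V ⥤ Nom V :=
  sumFunctor (constFunctor (names V)) (sigmaFunctor fun o : B.Op => listProd absPow (B.ar o))

/-- The natural transformation `q : F ⟶ F_α` induced by `θ`. -/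
def quotNat : rawFunctor V B ⟶ alphaFunctor V B :=
  sumNat (𝟙 (constFunctor (names V))) (sigmaNat fun o : B.Op => listProdNat powNat (B.ar o))

end Signature

/-! ### Final sequences and coalgebras -/

section Chains

variable {V : Type u} [DecidableEq V]

/-- The nominal set `Gⁿ1`. -/
def stage (G : Nom V ⥤ Nom V) : ℕ → Nom V
  | 0 => one V
  | n + 1 => G.obj (stage G n)

/-- The map `Gⁿ⁺¹1 ⟶ Gⁿ1` of the final sequence, that is `Gⁿ` applied to `G1 ⟶ 1`. -/
def stageMap (G : Nom V ⥤ Nom V) : ∀ n : ℕ, stage G (n + 1) ⟶ stage G n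
  | 0 => toOne _
  | n + 1 => G.map (stageMap G n)

/-- The limit in the category of sets of the final sequence `1 ⟵ G1 ⟵ G²1 ⟵ ⋯`: all
sequences, not only the finitely supported ones. -/
def LimStage (G : Nom V ⥤ Nom V) : Type u :=
  {s : ∀ n, stage G n // ∀ n, (stageMap G n).toFun (s (n + 1)) = s n}

/-- The maps `Gⁿ1 ⟶ Hⁿ1` induced by `q : G ⟶ H`: the identity for `n = 0`, and
`q_{Hⁿ1} ∘ G(aₙ)` for `n + 1`. -/
def stageNat {G H : Nom V ⥤ Nom V} (q : G ⟶ H) : ∀ n : ℕ, stage G n ⟶ stage H n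
  | 0 => 𝟙 (one V)
  | n + 1 => G.map (stageNat q n) ≫ q.app (stage H n)

theorem stageNat_comm {G H : Nom V ⥤ Nom V} (q : G ⟶ H) :
    ∀ n, stageNat q (n + 1) ≫ stageMap H n = stageMap G n ≫ stageNat q n
  | 0 => rfl
  | n + 1 => by
    change (G.map (stageNat q (n + 1)) ≫ q.app (stage H (n + 1))) ≫ H.map (stageMap H n) =
      G.map (stageMap G n) ≫ G.map (stageNat q n) ≫ q.app (stage H n)
    rw [Category.assoc, ← q.naturality, ← Category.assoc, ← Category.assoc, ← G.map_comp,
      ← G.map_comp, stageNat_comm q n]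

/-- The map `lim U Gⁿ1 → lim U Hⁿ1` induced by `q : G ⟶ H`. -/
def limNat {G H : Nom V ⥤ Nom V} (q : G ⟶ H) (s : LimStage G) : LimStage H :=
  ⟨fun n => (stageNat q n).toFun (s.1 n), fun n => by
    have h := congrArg (fun f => f.toFun (s.1 (n + 1))) (stageNat_comm q n)
    simp only [comp_toFun] at h
    rw [h, s.2 n]⟩

/-- The cone of a coalgebra `T ⟶ G T` over the final sequence. -/
def cone {G : Nom V ⥤ Nom V} (T : Endofunctor.Coalgebra G) : ∀ n : ℕ, T.V ⟶ stage G n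
  | 0 => toOne _
  | n + 1 => T.str ≫ G.map (cone T n)

theorem cone_comm {G : Nom V ⥤ Nom V} (T : Endofunctor.Coalgebra G) :
    ∀ n, cone T (n + 1) ≫ stageMap G n = cone T n
  | 0 => rfl
  | n + 1 => by
    change (T.str ≫ G.map (cone T (n + 1))) ≫ G.map (stageMap G n) = T.str ≫ G.map (cone T n)
    rw [Category.assoc, ← G.map_comp, cone_comm T n]

/-- The map `ι : U T → lim U Gⁿ1` induced by the cone of a coalgebra `T`. -/
def toLim {G : Nom V ⥤ Nom V} (T : Endofunctor.Coalgebra G) (t : T.V) : LimStage G :=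
  ⟨fun n => (cone T n).toFun t, fun n =>
    congrArg (fun f => f.toFun t) (cone_comm T n)⟩

end Chains

/-! ### Safe maps and safe squares -/

section Safe

variable {V : Type u} [DecidableEq V]

/-- `u` is `f`-safe: `|supp u|` is the maximum of the `|supp v|` for `v` in the fibre
of `f` through `u`. -/
def IsSafeElement {X Y : Nom V} (f : X ⟶ Y) (u : X) : Prop :=
  IsGreatest ((fun v : X => (supp v).ncard) '' {v | f.toFun v = f.toFun u}) (supp u).ncard

/-- A safe map: every point of the codomain has a safe preimage. -/
def IsSafeMap {X Y : Nom V} (f : X ⟶ Y) : Prop :=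
  ∀ v : Y, ∃ u : X, IsSafeElement f u ∧ f.toFun u = v

/-- `bv_f(u) = supp(u) \ supp(f(u))`. -/
def boundVars {X Y : Nom V} (f : X ⟶ Y) (u : X) : Set V :=
  supp u \ supp (f.toFun u)

/-- The square with top `p : Z ⟶ X`, left `f : X ⟶ W`, right `g : Z ⟶ Y` and bottom `q : Y ⟶ W`
is commutative and safe. -/
def IsSafeSquare {X Y Z W : Nom V} (p : Z ⟶ X) (f : X ⟶ W) (g : Z ⟶ Y) (q : Y ⟶ W) : Prop :=
  p ≫ f = g ≫ q ∧
    ∀ u : X, IsSafeElement f u → ∀ v : Y, f.toFun u = q.toFun v →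
      Disjoint (boundVars f u) (supp v) →
        ∃ z : Z, IsSafeElement g z ∧ p.toFun z = u ∧ g.toFun z = v

end Safe

end Nominal

/-! For an equivariant `f`, the number of names in `supp u` splits as the number of bound variables
`boundVars f u` plus the size of `supp (f u)`. The second summand is constant on fibres, so `u` is
safe exactly when it has as many bound variables as its fibre allows. A safe map is thus one with a
function `N` on its codomain that records an attained maximum (`IsGrading`). Such gradings compose
simply: they add over products, and abstracting a name adds one.

The second ingredient is renaming. A permutation that fixes `supp (f u)` keeps `u` in its fibre and
keeps it safe, and can move its bound variables off any finite set (`IsSafeMap.exists_fresh`). In a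
safe square only those bound variables of the lift `z` that do not occur in `p z` can be moved, but
the remaining ones are bound variables of `p z` already (`IsSafeSquare.exists_fresh`).

With these, passing from `f` to `q ∘ G f` preserves safe maps and safe squares for each constructor
of the signature functors (`PreservesSafety`), and (1) and (2) follow by induction on the stage. For
(3), safe preimages of the approximants of `t` are lifted stage by stage, with bound variables kept
disjoint from the one finite set `supp t`. This set contains the support of every approximant, so
each square can be applied. -/

namespace Nominal

/-! ### Supports and renaming away from finite sets -/

section Support

variable {V : Type u} [DecidableEq V] {X Y : Nom V}

theorem supp_map_subset (f : X ⟶ Y) (x : X) : supp (f.toFun x) ⊆ supp x :=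
  fun _ ha S hS => ha S fun π hπ => by rw [← f.equivariant, hS π hπ]

theorem supp_map_of_injective (f : X ⟶ Y) (hf : Function.Injective f.toFun) (x : X) :
    supp (f.toFun x) = supp x :=
  (supp_map_subset f x).antisymm fun _ ha S hS =>
    ha S fun π hπ => hf (by rw [f.equivariant, hS π hπ])

theorem supp_subset_of_finite {X : Nom V} {x : X} {S : Set V} (hS : S.Finite)
    (h : MulAction.Supports (FinPerm V) S x) : supp x ⊆ S := by
  have := supp_subset (x := x) (S := hS.toFinset) (by rwa [hS.coe_toFinset])
  rwa [hS.coe_toFinset] at this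

theorem supp_smul (π : FinPerm V) (x : X) : supp (π • x) = (fun a => π • a) '' supp x := by
  ext a
  constructor
  · intro h
    refine ⟨π⁻¹ • a, mem_supp_of_smul (π := π) ?_, smul_inv_smul π a⟩
    rwa [smul_inv_smul]
  · rintro ⟨b, hb, rfl⟩
    refine mem_supp_of_smul (π := π⁻¹) ?_
    rwa [inv_smul_smul, inv_smul_smul]

theorem ncard_supp_smul (π : FinPerm V) (x : X) : (supp (π • x)).ncard = (supp x).ncard := by
  rw [supp_smul, Set.ncard_image_of_injective _ (MulAction.injective π)]

theorem smul_eq_self [Infinite V] {π : FinPerm V} {x : X} (h : ∀ a ∈ supp x, π • a = a) :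
    π • x = x :=
  supports_supp x π fun _ ha => h _ ha

theorem supp_names [Infinite V] (x : V) : supp (X := names V) x = {x} := by
  refine (supp_subset_of_finite (X := names V) (Set.finite_singleton x) fun π h => h rfl).antisymm
    (Set.singleton_subset_iff.2 ?_)
  by_contra h
  obtain ⟨c, hc⟩ := ((supp_finite (X := names V) x).union (Set.finite_singleton x)).exists_notMem
  simp only [Set.mem_union, Set.mem_singleton_iff, not_or] at hc
  have : transp x c • x = x := transp_smul_of_notMem_supp (X := names V) h hc.1
  exact hc.2 ((Equiv.swap_apply_left x c).symm.trans this)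

theorem supp_pair [Infinite V] (x : X) (y : Y) :
    supp (X := prod X Y) (x, y) = supp x ∪ supp y := by
  refine (supp_subset_of_finite ((supp_finite x).union (supp_finite y)) fun π h =>
    Prod.ext ?_ ?_).antisymm (Set.union_subset ?_ ?_)
  · exact smul_eq_self fun a ha => h (Or.inl ha)
  · exact smul_eq_self fun a ha => h (Or.inr ha)
  · exact supp_map_subset (X := prod X Y) (Y := X) ⟨Prod.fst, fun _ _ => rfl⟩ (x, y)
  · exact supp_map_subset (X := prod X Y) (Y := Y) ⟨Prod.snd, fun _ _ => rfl⟩ (x, y)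

/-- The coproduct injection on the left. -/
def sumInl (X Y : Nom V) : X ⟶ sum X Y := ⟨Sum.inl, fun _ _ => rfl⟩

/-- The coproduct injection on the right. -/
def sumInr (X Y : Nom V) : Y ⟶ sum X Y := ⟨Sum.inr, fun _ _ => rfl⟩

/-- The injections into an arbitrary coproduct. -/
def sigmaIn {I : Type u} (X : I → Nom V) (i : I) : X i ⟶ sigma X :=
  ⟨fun x => (⟨i, x⟩ : Σ i, X i), fun _ _ => rfl⟩

theorem sigmaIn_injective {I : Type u} (X : I → Nom V) (i : I) :
    Function.Injective (sigmaIn X i).toFun :=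
  sigma_mk_injective (β := fun i => X i)

/-- Induction on `T`: each new name outside `S` is sent to an unused name by one further
transposition, which disturbs no earlier choice. -/
theorem exists_smul_notMem [Infinite V] {S T A : Set V} (hS : S.Finite) (hT : T.Finite)
    (hA : A.Finite) :
    ∃ π : FinPerm V, (∀ a ∈ S, π • a = a) ∧ ∀ a ∈ T, a ∉ S → π • a ∉ A := by
  induction T, hT using Set.Finite.induction_on with
  | empty => exact ⟨1, fun a _ => one_smul _ a, fun a ha => ha.elim⟩
  | @insert d T _ hT ih =>
    obtain ⟨π, h1, h2⟩ := ih
    by_cases hd : d ∈ S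
    · refine ⟨π, h1, fun a ha haS => h2 a (ha.resolve_left ?_) haS⟩
      rintro rfl
      exact haS hd
    · by_cases hdT : d ∈ T
      · exact ⟨π, h1, fun a ha => h2 a (ha.elim (fun e => e ▸ hdT) id)⟩
      · obtain ⟨c, hc⟩ := ((hA.union hS).union (hT.image fun a => π • a)).exists_notMem
        simp only [Set.mem_union, not_or] at hc
        obtain ⟨⟨hcA, hcS⟩, hcT⟩ := hc
        -- The extra transposition swaps `π • d` with the fresh `c`, so it changes the image of no
        -- name except `d` and the one sent to `c`; no name of `S` or `T` is sent there.
        have key : ∀ a, a ≠ d → π • a ≠ c → (transp (π • d) c * π) • a = π • a := by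
          intro a had hac
          rw [mul_smul]
          exact Equiv.swap_apply_of_ne_of_ne (fun e => had (smul_left_cancel π e)) hac
        refine ⟨transp (π • d) c * π, fun a ha => ?_, fun a ha haS => ?_⟩
        · rw [key a, h1 a ha]
          · rintro rfl; exact hd ha
          · rw [h1 a ha]; rintro rfl; exact hcS ha
        · rcases ha with rfl | ha
          · rw [mul_smul]
            have : transp (π • a) c • (π • a) = c := Equiv.swap_apply_left _ _
            rwa [this]
          · rw [key a]
            · exact h2 a ha haS
            · rintro rfl; exact hdT ha
            · rintro rfl; exact hcT ⟨a, ha, rfl⟩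

theorem exists_fresh_smul [Infinite V] (x : X) {S A : Set V} (hS : S.Finite) (hA : A.Finite) :
    ∃ π : FinPerm V, (∀ a ∈ S, π • a = a) ∧ Disjoint (supp (π • x) \ S) A := by
  obtain ⟨π, h1, h2⟩ := exists_smul_notMem hS (supp_finite x) hA
  refine ⟨π, h1, Set.disjoint_left.2 ?_⟩
  rintro _ ⟨ha, haS⟩
  rw [supp_smul] at ha
  obtain ⟨b, hb, rfl⟩ := ha
  exact h2 b hb fun hbS => haS (by simpa only [h1 b hbS] using hbS)

end Support

/-! ### Name abstraction: supports and concretion -/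

section Abstraction

variable {V : Type u} [DecidableEq V] [Infinite V] {X : Nom V}

/-- The abstraction `⟨x⟩u`. -/
def bind (x : V) (u : X) : abs X := Quotient.mk (absSetoid X) (x, u)

theorem smul_bind (π : FinPerm V) (x : V) (u : X) : π • bind x u = bind (π • x) (π • u) := rfl

/-- With equal binders, `AbsRel` applies the same transposition to both bodies, and it cancels. -/
theorem bind_injective {x : V} {u v : X} (h : bind x u = bind x v) : u = v := by
  obtain ⟨z, -, h⟩ : AbsRel X (x, u) (x, v) := Quotient.exact h
  exact smul_left_cancel _ h

theorem bind_eq_bind_transp {x z : V} {u : X} (hzx : z ≠ x) (hz : z ∉ supp u) :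
    bind x u = bind z (transp x z • u) := by
  refine Quotient.sound (s := absSetoid X) ?_
  obtain ⟨w, hw⟩ := (((supp_finite u).union (supp_finite (transp x z • u))).union
    (Set.toFinite {x, z})).exists_notMem
  simp only [Set.mem_union, Set.mem_insert_iff, Set.mem_singleton_iff, not_or] at hw
  obtain ⟨⟨h1, h2⟩, h3, h4⟩ := hw
  exact ⟨w, ⟨h3, h1, h4, h2⟩, transp_smul_fresh hzx h3 hz h1⟩

theorem supp_bind_subset (x : V) (u : X) : supp (bind x u) ⊆ insert x (supp u) := by
  refine supp_subset_of_finite ((supp_finite u).insert x) fun π h => ?_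
  have h1 : π • x = x := h (Set.mem_insert _ _)
  rw [smul_bind, h1, smul_eq_self fun a ha => h (Set.mem_insert_of_mem _ ha)]

theorem supp_bind (x : V) (u : X) : supp (bind x u) = supp u \ {x} := by
  refine Set.Subset.antisymm (fun a ha => ?_) ?_
  · have hax : a ≠ x := by
      rintro rfl
      obtain ⟨z, hz⟩ := ((supp_finite u).insert a).exists_notMem
      simp only [Set.mem_insert_iff, not_or] at hz
      -- With binder `z` instead of `a`, the name `a` would have to lie in the support of the
      -- renamed body, hence `z` in `supp u`.
      rw [bind_eq_bind_transp hz.1 hz.2] at ha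
      rcases supp_bind_subset _ _ ha with h | h
      · exact hz.1 h.symm
      · have h' : transp a z • z = a := Equiv.swap_apply_right a z
        refine hz.2 (mem_supp_of_smul (π := transp a z) ?_)
        rwa [h']
    exact ⟨(supp_bind_subset _ _ ha).resolve_left hax, hax⟩
  · rintro a ⟨ha, hax⟩
    by_contra hb
    obtain ⟨c, hc⟩ := (((supp_finite u).union (supp_finite (bind x u))).insert x).exists_notMem
    simp only [Set.mem_insert_iff, Set.mem_union, not_or] at hc
    -- Swapping `a` with a fresh `c` fixes `⟨x⟩u` and `x`, hence fixes `u`; then `a ∈ supp u` forces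
    -- `c ∈ supp u`.
    have h1 := transp_smul_of_notMem_supp hb hc.2.2
    have h2 : transp a c • x = x := Equiv.swap_apply_of_ne_of_ne (Ne.symm hax) (Ne.symm hc.1)
    rw [smul_bind, h2] at h1
    have h3 := bind_injective h1
    have h4 : transp a c • c = a := Equiv.swap_apply_right a c
    refine hc.2.1 (mem_supp_of_smul (π := transp a c) ?_)
    rwa [h3, h4]

theorem exists_eq_bind {x : V} {v : abs X} (hx : x ∉ supp v) : ∃ u : X, v = bind x u := by
  obtain ⟨⟨y, u⟩, rfl⟩ := Quotient.exists_rep v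
  change x ∉ supp (bind y u) at hx
  rw [supp_bind] at hx
  by_cases h : x = y
  · exact ⟨u, h ▸ rfl⟩
  · exact ⟨_, bind_eq_bind_transp h fun hu => hx ⟨hu, h⟩⟩

end Abstraction

/-! ### Safety as a maximal count of bound variables -/

section Grading

variable {V : Type u} [DecidableEq V] {X Y Z W : Nom V}

theorem isSafeElement_iff {f : X ⟶ Y} {u : X} :
    IsSafeElement f u ↔ ∀ v, f.toFun v = f.toFun u → (supp v).ncard ≤ (supp u).ncard :=
  ⟨fun h v hv => h.2 ⟨v, hv, rfl⟩, fun h => ⟨⟨u, rfl, rfl⟩, by rintro _ ⟨v, hv, rfl⟩; exact h v hv⟩⟩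

theorem IsSafeElement.smul {f : X ⟶ Y} {u : X} (h : IsSafeElement f u) {π : FinPerm V}
    (hπ : f.toFun (π • u) = f.toFun u) : IsSafeElement f (π • u) := by
  rw [isSafeElement_iff] at *
  intro v hv
  rw [ncard_supp_smul]
  exact h v (hv.trans hπ)

theorem boundVars_finite (f : X ⟶ Y) (u : X) : (boundVars f u).Finite :=
  (supp_finite u).sdiff

theorem ncard_supp_eq (f : X ⟶ Y) (u : X) :
    (supp u).ncard = (boundVars f u).ncard + (supp (f.toFun u)).ncard :=
  (Set.ncard_sdiff_add_ncard_of_subset (supp_map_subset f u) (supp_finite u)).symm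

/-- `N` bounds the number of bound variables in each fibre of `f`, and the bound is attained. -/
structure IsGrading (f : X ⟶ Y) (N : Y → ℕ) : Prop where
  ncard_le : ∀ u, (boundVars f u).ncard ≤ N (f.toFun u)
  exists_eq : ∀ v, ∃ u, f.toFun u = v ∧ (boundVars f u).ncard = N v

/-- By `ncard_supp_eq`, comparing supports within a fibre amounts to comparing numbers of bound
variables. -/
theorem IsGrading.isSafeElement_iff {f : X ⟶ Y} {N : Y → ℕ} (h : IsGrading f N) {u : X} :
    IsSafeElement f u ↔ N (f.toFun u) ≤ (boundVars f u).ncard := by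
  rw [Nominal.isSafeElement_iff]
  constructor
  · intro hu
    obtain ⟨v, hv, hN⟩ := h.exists_eq (f.toFun u)
    have := hu v hv
    rw [ncard_supp_eq f, ncard_supp_eq f u, hv] at this
    omega
  · intro hu v hv
    have := h.ncard_le v
    rw [ncard_supp_eq f, ncard_supp_eq f u]
    rw [hv] at *
    omega

theorem IsGrading.isSafeMap {f : X ⟶ Y} {N : Y → ℕ} (h : IsGrading f N) : IsSafeMap f := by
  intro v
  obtain ⟨u, rfl, hN⟩ := h.exists_eq v
  exact ⟨u, h.isSafeElement_iff.2 hN.ge, rfl⟩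

theorem IsSafeMap.exists_isGrading {f : X ⟶ Y} (h : IsSafeMap f) : ∃ N, IsGrading f N := by
  choose s hs hfs using h
  refine ⟨fun v => (boundVars f (s v)).ncard, fun u => ?_, fun v => ⟨s v, hfs v, rfl⟩⟩
  have := Nominal.isSafeElement_iff.1 (hs (f.toFun u)) u (hfs _).symm
  rw [ncard_supp_eq f, ncard_supp_eq f (s _), hfs] at this
  omega

theorem isSafeMap_id (X : Nom V) : IsSafeMap (𝟙 X) := fun v =>
  ⟨v, isSafeElement_iff.2 fun w hw => by rw [show w = v from hw], rfl⟩

/-- A name free in `f (p z) = r (g z)` is free in `g z`, so a bound variable of `z` that survives in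
`p z` stays bound there. -/
theorem mem_boundVars_of_square {p : Z ⟶ X} {f : X ⟶ W} {g : Z ⟶ Y} {r : Y ⟶ W}
    (h : p ≫ f = g ≫ r) {z : Z} {a : V} (ha : a ∈ boundVars g z) (hp : a ∈ supp (p.toFun z)) :
    a ∈ boundVars f (p.toFun z) := by
  refine ⟨hp, fun hf => ha.2 ?_⟩
  have := congrArg (fun k => k.toFun z) h
  simp only [comp_toFun] at this
  rw [this] at hf
  exact supp_map_subset r _ hf

/-- Injective equivariant maps preserve supports, so safety transfers once `i` identifies the two
fibres. Used for coproduct injections. -/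
theorem isSafeElement_iff_of_injective {X Y X' Y' : Nom V} {f : X ⟶ Y} {f' : X' ⟶ Y'}
    {i : X ⟶ X'} {u : X} (hi : Function.Injective i.toFun)
    (h : ∀ v', f'.toFun v' = f'.toFun (i.toFun u) ↔ ∃ v, f.toFun v = f.toFun u ∧ i.toFun v = v') :
    IsSafeElement f' (i.toFun u) ↔ IsSafeElement f u := by
  simp only [isSafeElement_iff, h, supp_map_of_injective i hi]
  constructor
  · intro k v hv
    simpa only [supp_map_of_injective i hi] using k (i.toFun v) ⟨v, hv, rfl⟩
  · rintro k _ ⟨v, hv, rfl⟩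
    rw [supp_map_of_injective i hi]
    exact k v hv

variable [Infinite V]

theorem IsSafeMap.exists_fresh {f : X ⟶ Y} (h : IsSafeMap f) (v : Y) {A : Set V}
    (hA : A.Finite) :
    ∃ u, IsSafeElement f u ∧ f.toFun u = v ∧ Disjoint (boundVars f u) A := by
  obtain ⟨u, hu, rfl⟩ := h v
  obtain ⟨π, h1, h2⟩ := exists_fresh_smul u (supp_finite (f.toFun u)) hA
  have h3 : f.toFun (π • u) = f.toFun u := by rw [f.equivariant, smul_eq_self h1]
  refine ⟨π • u, hu.smul h3, h3, ?_⟩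
  rwa [boundVars, h3]

/-- The lift is renamed by a permutation fixing both `supp (p z)` and `supp (g z)`, so both
projections are unchanged. Bound variables in `supp (p z)` cannot move, but
`mem_boundVars_of_square` puts them in `boundVars f u`. -/
theorem IsSafeSquare.exists_fresh {p : Z ⟶ X} {f : X ⟶ W} {g : Z ⟶ Y} {r : Y ⟶ W}
    (h : IsSafeSquare p f g r) {u : X} (hu : IsSafeElement f u) {v : Y}
    (huv : f.toFun u = r.toFun v) (hd : Disjoint (boundVars f u) (supp v)) {A : Set V}
    (hA : A.Finite) :
    ∃ z, IsSafeElement g z ∧ p.toFun z = u ∧ g.toFun z = v ∧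
      ∀ a ∈ boundVars g z, a ∈ A → a ∈ boundVars f u := by
  obtain ⟨z, hz, rfl, rfl⟩ := h.2 u hu v huv hd
  obtain ⟨π, h1, h2⟩ := exists_fresh_smul z
    ((supp_finite (p.toFun z)).union (supp_finite (g.toFun z))) hA
  have hp : p.toFun (π • z) = p.toFun z := by
    rw [p.equivariant, smul_eq_self fun a ha => h1 a (Or.inl ha)]
  have hg : g.toFun (π • z) = g.toFun z := by
    rw [g.equivariant, smul_eq_self fun a ha => h1 a (Or.inr ha)]
  refine ⟨π • z, hz.smul hg, hp, hg, fun a ha haA => ?_⟩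
  by_cases hpa : a ∈ supp (p.toFun z)
  · rw [← hp] at hpa ⊢
    exact mem_boundVars_of_square h.1 ha hpa
  · exact (Set.disjoint_left.1 h2 ⟨ha.1, fun h' => h'.elim hpa (hg ▸ ha.2)⟩ haA).elim

end Grading

/-! ### Closure of safe maps and squares under the constructors -/

section Closure

variable {V : Type u} [DecidableEq V]

section Prod

variable [Infinite V] {X₁ X₂ Y₁ Y₂ Z₁ Z₂ W₁ W₂ : Nom V}

/-- The product of two maps. -/
def prodMap (f : X₁ ⟶ Y₁) (g : X₂ ⟶ Y₂) : prod X₁ X₂ ⟶ prod Y₁ Y₂ :=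
  ⟨fun p => (f.toFun p.1, g.toFun p.2), fun π p =>
    Prod.ext (f.equivariant π p.1) (g.equivariant π p.2)⟩

theorem boundVars_prodMap (f : X₁ ⟶ Y₁) (g : X₂ ⟶ Y₂) (u : X₁) (v : X₂) :
    boundVars (prodMap f g) (u, v) =
      (boundVars f u \ supp (g.toFun v)) ∪ (boundVars g v \ supp (f.toFun u)) := by
  change supp (X := prod X₁ X₂) (u, v) \ supp (X := prod Y₁ Y₂) (f.toFun u, g.toFun v) = _
  rw [supp_pair, supp_pair]
  ext a
  simp only [boundVars, Set.mem_sdiff, Set.mem_union]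
  tauto

theorem boundVars_prodMap_of_disjoint {f : X₁ ⟶ Y₁} {g : X₂ ⟶ Y₂} {u : X₁} {v : X₂}
    (h1 : Disjoint (boundVars f u) (supp (g.toFun v)))
    (h2 : Disjoint (boundVars g v) (supp (f.toFun u)))
    (h3 : Disjoint (boundVars f u) (boundVars g v)) :
    (boundVars (prodMap f g) (u, v)).ncard = (boundVars f u).ncard + (boundVars g v).ncard := by
  rw [boundVars_prodMap, h1.sdiff_eq_left, h2.sdiff_eq_left,
    Set.ncard_union_eq h3 (boundVars_finite _ _) (boundVars_finite _ _)]

theorem IsGrading.prodMap {f : X₁ ⟶ Y₁} {g : X₂ ⟶ Y₂} {N : Y₁ → ℕ} {M : Y₂ → ℕ}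
    (hf : IsGrading f N) (hg : IsGrading g M) :
    IsGrading (prodMap f g) (fun p : Y₁ × Y₂ => N p.1 + M p.2) where
  ncard_le := by
    rintro ⟨u, v⟩
    rw [boundVars_prodMap]
    refine (Set.ncard_union_le _ _).trans (add_le_add ?_ ?_)
    · exact (Set.ncard_le_ncard Set.sdiff_subset (boundVars_finite _ _)).trans (hf.ncard_le u)
    · exact (Set.ncard_le_ncard Set.sdiff_subset (boundVars_finite _ _)).trans (hg.ncard_le v)
  exists_eq := by
    rintro ⟨x, y⟩
    -- Choosing `v` after `u` and fresh for all of `supp u` avoids both the bound and the free names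
    -- of `u`.
    obtain ⟨u, hu, rfl, hd⟩ := hf.isSafeMap.exists_fresh x (supp_finite y)
    obtain ⟨v, hv, rfl, hd'⟩ := hg.isSafeMap.exists_fresh y (supp_finite u)
    refine ⟨(u, v), rfl, ?_⟩
    rw [boundVars_prodMap_of_disjoint hd (hd'.mono_right (supp_map_subset f u))
      (hd'.mono_right Set.sdiff_subset).symm]
    exact congrArg₂ (· + ·) (le_antisymm (hf.ncard_le u) (hf.isSafeElement_iff.1 hu))
      (le_antisymm (hg.ncard_le v) (hg.isSafeElement_iff.1 hv))

theorem IsSafeMap.prodMap {f : X₁ ⟶ Y₁} {g : X₂ ⟶ Y₂} (hf : IsSafeMap f) (hg : IsSafeMap g) :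
    IsSafeMap (prodMap f g) :=
  let ⟨_, hN⟩ := hf.exists_isGrading
  let ⟨_, hM⟩ := hg.exists_isGrading
  (hN.prodMap hM).isSafeMap

/-- The chain `|bv (u, v)| ≤ |bv u ∪ bv v| ≤ |bv u| + |bv v| ≤ N + M` collapses to equalities when
the pair is safe. -/
theorem IsSafeElement.of_prodMap {f : X₁ ⟶ Y₁} {g : X₂ ⟶ Y₂} (hf : IsSafeMap f)
    (hg : IsSafeMap g) {u : X₁} {v : X₂} (h : IsSafeElement (Nominal.prodMap f g) (u, v)) :
    IsSafeElement f u ∧ IsSafeElement g v ∧ Disjoint (boundVars f u) (boundVars g v) ∧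
      boundVars (Nominal.prodMap f g) (u, v) = boundVars f u ∪ boundVars g v := by
  obtain ⟨N, hN⟩ := hf.exists_isGrading
  obtain ⟨M, hM⟩ := hg.exists_isGrading
  have h1 := (hN.prodMap hM).isSafeElement_iff.1 h
  change N (f.toFun u) + M (g.toFun v) ≤ _ at h1
  have h2 := hN.ncard_le u
  have h3 := hM.ncard_le v
  have hsub : boundVars (Nominal.prodMap f g) (u, v) ⊆ boundVars f u ∪ boundVars g v := by
    rw [boundVars_prodMap]
    exact Set.union_subset_union Set.sdiff_subset Set.sdiff_subset
  have hfin := (boundVars_finite f u).union (boundVars_finite g v)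
  have h4 := Set.ncard_le_ncard hsub hfin
  have h5 := Set.ncard_union_add_ncard_inter (boundVars f u) (boundVars g v)
    (boundVars_finite f u) (boundVars_finite g v)
  rw [hN.isSafeElement_iff, hM.isSafeElement_iff, Set.disjoint_iff_inter_eq_empty,
    ← Set.ncard_eq_zero ((boundVars_finite f u).inter_of_left _)]
  exact ⟨by omega, by omega, by omega, Set.eq_of_subset_of_ncard_le hsub (by omega) hfin⟩

theorem IsSafeSquare.prodMap {p₁ : Z₁ ⟶ X₁} {f₁ : X₁ ⟶ W₁} {g₁ : Z₁ ⟶ Y₁} {r₁ : Y₁ ⟶ W₁}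
    {p₂ : Z₂ ⟶ X₂} {f₂ : X₂ ⟶ W₂} {g₂ : Z₂ ⟶ Y₂} {r₂ : Y₂ ⟶ W₂}
    (hf₁ : IsSafeMap f₁) (hf₂ : IsSafeMap f₂) (hg₁ : IsSafeMap g₁) (hg₂ : IsSafeMap g₂)
    (h₁ : IsSafeSquare p₁ f₁ g₁ r₁) (h₂ : IsSafeSquare p₂ f₂ g₂ r₂) :
    IsSafeSquare (Nominal.prodMap p₁ p₂) (Nominal.prodMap f₁ f₂) (Nominal.prodMap g₁ g₂)
      (Nominal.prodMap r₁ r₂) := by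
  refine ⟨hom_ext fun p => Prod.ext (congrArg (fun k => k.toFun p.1) h₁.1)
    (congrArg (fun k => k.toFun p.2) h₂.1), ?_⟩
  rintro ⟨u₁, u₂⟩ hu ⟨v₁, v₂⟩ huv hd
  obtain ⟨hu₁, hu₂, hdu, hbv⟩ := hu.of_prodMap hf₁ hf₂
  rw [hbv, supp_pair, Set.disjoint_union_left, Set.disjoint_union_right,
    Set.disjoint_union_right] at hd
  obtain ⟨⟨d11, d12⟩, d21, d22⟩ := hd
  -- Including `supp u₂` in the set avoided by `z₁` handles names that `z₂` is forced to share with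
  -- `u₂`.
  obtain ⟨z₁, hz₁, hp₁, rfl, k₁⟩ := h₁.exists_fresh hu₁ (congrArg Prod.fst huv) d11
    ((supp_finite v₂).union (supp_finite u₂))
  obtain ⟨z₂, hz₂, hp₂, rfl, k₂⟩ := h₂.exists_fresh hu₂ (congrArg Prod.snd huv) d22
    (supp_finite z₁)
  refine ⟨(z₁, z₂), ?_, Prod.ext hp₁ hp₂, rfl⟩
  obtain ⟨N, hN⟩ := hg₁.exists_isGrading
  obtain ⟨M, hM⟩ := hg₂.exists_isGrading
  refine (hN.prodMap hM).isSafeElement_iff.2 ?_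
  rw [boundVars_prodMap_of_disjoint]
  · exact add_le_add (hN.isSafeElement_iff.1 hz₁) (hM.isSafeElement_iff.1 hz₂)
  · exact Set.disjoint_left.2 fun a ha hb =>
      Set.disjoint_left.1 d12 (k₁ a ha (Or.inl hb)) hb
  · exact Set.disjoint_left.2 fun a ha hb =>
      Set.disjoint_left.1 d21 (k₂ a ha (supp_map_subset g₁ _ hb)) hb
  · refine Set.disjoint_left.2 fun a ha hb => ?_
    -- A common bound variable of `z₁` and `z₂` would be one of `u₂` by `k₂`, then also one of `u₁`
    -- by `k₁`, but those are disjoint.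
    have hb' := k₂ a hb ha.1
    exact Set.disjoint_left.1 hdu (k₁ a ha (Or.inr hb'.1)) hb'

end Prod

section Sum

variable {X₁ X₂ Y₁ Y₂ Z₁ Z₂ W₁ W₂ : Nom V}

/-- The coproduct of two maps. -/
def sumMap (f : X₁ ⟶ Y₁) (g : X₂ ⟶ Y₂) : sum X₁ X₂ ⟶ sum Y₁ Y₂ :=
  ⟨Sum.map f.toFun g.toFun, by
    rintro π (x | y)
    · exact congrArg Sum.inl (f.equivariant π x)
    · exact congrArg Sum.inr (g.equivariant π y)⟩

theorem isSafeElement_sumMap_inl {f : X₁ ⟶ Y₁} {g : X₂ ⟶ Y₂} {u : X₁} :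
    IsSafeElement (sumMap f g) (Sum.inl u : X₁ ⊕ X₂) ↔ IsSafeElement f u :=
  isSafeElement_iff_of_injective (i := sumInl X₁ X₂) Sum.inl_injective <| by
    rintro (v | v)
    · exact ⟨fun h => ⟨v, Sum.inl_injective h, rfl⟩, fun ⟨w, hw, e⟩ => by
        obtain rfl := Sum.inl_injective e
        exact congrArg Sum.inl hw⟩
    · exact ⟨fun h => (Sum.inr_ne_inl h).elim, fun ⟨_, _, e⟩ => (Sum.inl_ne_inr e).elim⟩

theorem isSafeElement_sumMap_inr {f : X₁ ⟶ Y₁} {g : X₂ ⟶ Y₂} {u : X₂} :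
    IsSafeElement (sumMap f g) (Sum.inr u : X₁ ⊕ X₂) ↔ IsSafeElement g u :=
  isSafeElement_iff_of_injective (i := sumInr X₁ X₂) Sum.inr_injective <| by
    rintro (v | v)
    · exact ⟨fun h => (Sum.inl_ne_inr h).elim, fun ⟨_, _, e⟩ => (Sum.inr_ne_inl e).elim⟩
    · exact ⟨fun h => ⟨v, Sum.inr_injective h, rfl⟩, fun ⟨w, hw, e⟩ => by
        obtain rfl := Sum.inr_injective e
        exact congrArg Sum.inr hw⟩

theorem IsSafeMap.sumMap {f : X₁ ⟶ Y₁} {g : X₂ ⟶ Y₂} (hf : IsSafeMap f) (hg : IsSafeMap g) :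
    IsSafeMap (sumMap f g) := by
  rintro (v | v)
  · obtain ⟨u, hu, rfl⟩ := hf v
    exact ⟨Sum.inl u, isSafeElement_sumMap_inl.2 hu, rfl⟩
  · obtain ⟨u, hu, rfl⟩ := hg v
    exact ⟨Sum.inr u, isSafeElement_sumMap_inr.2 hu, rfl⟩

theorem IsSafeSquare.sumMap {p₁ : Z₁ ⟶ X₁} {f₁ : X₁ ⟶ W₁} {g₁ : Z₁ ⟶ Y₁} {r₁ : Y₁ ⟶ W₁}
    {p₂ : Z₂ ⟶ X₂} {f₂ : X₂ ⟶ W₂} {g₂ : Z₂ ⟶ Y₂} {r₂ : Y₂ ⟶ W₂}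
    (h₁ : IsSafeSquare p₁ f₁ g₁ r₁) (h₂ : IsSafeSquare p₂ f₂ g₂ r₂) :
    IsSafeSquare (Nominal.sumMap p₁ p₂) (Nominal.sumMap f₁ f₂) (Nominal.sumMap g₁ g₂)
      (Nominal.sumMap r₁ r₂) := by
  refine ⟨hom_ext ?_, ?_⟩
  · rintro (z | z)
    · exact congrArg (fun k => Sum.inl (k.toFun z)) h₁.1
    · exact congrArg (fun k => Sum.inr (k.toFun z)) h₂.1
  · rintro (u | u) hu (v | v) huv hd
    · obtain ⟨z, hz, rfl, rfl⟩ := h₁.2 u (isSafeElement_sumMap_inl.1 hu) v (Sum.inl_injective huv)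
        (by
          have e₁ := supp_map_of_injective (sumInl X₁ X₂) Sum.inl_injective u
          have e₂ := supp_map_of_injective (sumInl W₁ W₂) Sum.inl_injective (f₁.toFun u)
          have e₃ := supp_map_of_injective (sumInl Y₁ Y₂) Sum.inl_injective v
          rw [boundVars, ← e₁, ← e₂, ← e₃]
          exact hd)
      exact ⟨Sum.inl z, isSafeElement_sumMap_inl.2 hz, rfl, rfl⟩
    · exact (Sum.inl_ne_inr huv).elim
    · exact (Sum.inr_ne_inl huv).elim
    · obtain ⟨z, hz, rfl, rfl⟩ := h₂.2 u (isSafeElement_sumMap_inr.1 hu) v (Sum.inr_injective huv)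
        (by
          have e₁ := supp_map_of_injective (sumInr X₁ X₂) Sum.inr_injective u
          have e₂ := supp_map_of_injective (sumInr W₁ W₂) Sum.inr_injective (f₂.toFun u)
          have e₃ := supp_map_of_injective (sumInr Y₁ Y₂) Sum.inr_injective v
          rw [boundVars, ← e₁, ← e₂, ← e₃]
          exact hd)
      exact ⟨Sum.inr z, isSafeElement_sumMap_inr.2 hz, rfl, rfl⟩

end Sum

section Sigma

variable {I : Type u} {X Y Z W : I → Nom V}

/-- The coproduct of a family of maps. -/
def sigmaMap (f : ∀ i, X i ⟶ Y i) : sigma X ⟶ sigma Y :=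
  ⟨fun p => ⟨p.1, (f p.1).toFun p.2⟩, fun π p =>
    congrArg (Sigma.mk p.1) ((f p.1).equivariant π p.2)⟩

theorem isSafeElement_sigmaMap {f : ∀ i, X i ⟶ Y i} {i : I} {u : X i} :
    IsSafeElement (sigmaMap f) (⟨i, u⟩ : Σ i, X i) ↔ IsSafeElement (f i) u :=
  isSafeElement_iff_of_injective (i := sigmaIn X i) (sigmaIn_injective X i) <| by
    rintro ⟨j, v⟩
    constructor
    · intro h
      obtain rfl : j = i := congrArg (fun p : Σ i, Y i => p.1) h
      exact ⟨v, sigmaIn_injective Y _ h, rfl⟩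
    · rintro ⟨w, hw, e⟩
      obtain rfl : i = j := congrArg (fun p : Σ i, X i => p.1) e
      obtain rfl := sigmaIn_injective X _ e
      exact congrArg (sigmaIn Y i).toFun hw

theorem IsSafeMap.sigmaMap {f : ∀ i, X i ⟶ Y i} (hf : ∀ i, IsSafeMap (f i)) :
    IsSafeMap (sigmaMap f) := by
  rintro ⟨i, v⟩
  obtain ⟨u, hu, rfl⟩ := hf i v
  exact ⟨⟨i, u⟩, isSafeElement_sigmaMap.2 hu, rfl⟩

theorem IsSafeSquare.sigmaMap {p : ∀ i, Z i ⟶ X i} {f : ∀ i, X i ⟶ W i} {g : ∀ i, Z i ⟶ Y i}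
    {r : ∀ i, Y i ⟶ W i} (h : ∀ i, IsSafeSquare (p i) (f i) (g i) (r i)) :
    IsSafeSquare (Nominal.sigmaMap p) (Nominal.sigmaMap f) (Nominal.sigmaMap g)
      (Nominal.sigmaMap r) := by
  refine ⟨hom_ext ?_, ?_⟩
  · rintro ⟨i, z⟩
    exact congrArg (fun k : Z i ⟶ W i => (sigmaIn W i).toFun (k.toFun z)) (h i).1
  rintro ⟨i, u⟩ hu ⟨j, v⟩ huv hd
  obtain rfl : i = j := congrArg (fun p : Σ i, W i => p.1) huv
  obtain ⟨z, hz, rfl, rfl⟩ := (h i).2 u (isSafeElement_sigmaMap.1 hu) v (sigmaIn_injective W _ huv)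
    (by
      have e₁ := supp_map_of_injective (sigmaIn X i) (sigmaIn_injective X i) u
      have e₂ := supp_map_of_injective (sigmaIn W i) (sigmaIn_injective W i) ((f i).toFun u)
      have e₃ := supp_map_of_injective (sigmaIn Y i) (sigmaIn_injective Y i) v
      rw [boundVars, ← e₁, ← e₂, ← e₃]
      exact hd)
  exact ⟨⟨i, z⟩, isSafeElement_sigmaMap.2 hz, rfl, rfl⟩

end Sigma

section Bind

variable [Infinite V] {X Y Z W : Nom V}

/-- The map `(x, u) ↦ ⟨x⟩f(u)`. -/
def bindMap (f : X ⟶ Y) : prod (names V) X ⟶ abs Y := namesProd.map f ≫ theta.app Y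

theorem boundVars_bindMap (f : X ⟶ Y) (x : V) (u : X) :
    boundVars (bindMap f) (x, u) = insert x (boundVars f u) := by
  have h : supp (X := prod (names V) X) (x, u) = {x} ∪ supp u :=
    (supp_pair (X := names V) x u).trans (congrArg (· ∪ supp u) (supp_names x))
  refine (congrArg₂ (· \ ·) h (supp_bind x (f.toFun u))).trans ?_
  ext a
  simp only [boundVars, Set.mem_sdiff, Set.mem_union, Set.mem_singleton_iff, Set.mem_insert_iff]
  tauto

/-- The binder `x` is one more bound variable, provided `u` is renamed so that `x` is not already
bound in it. -/
theorem IsGrading.exists_bindMap {f : X ⟶ Y} {N : Y → ℕ} (hf : IsGrading f N) :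
    ∃ M, IsGrading (bindMap f) M ∧ ∀ x v, M (bind x v) = N v + 1 := by
  -- Permutations carry fibres to fibres and preserve counts, so `N` is invariant; this makes `N +
  -- 1` well defined on `[V]Y`.
  have hN : ∀ (π : FinPerm V) (v : Y), N (π • v) ≤ N v := by
    intro π v
    obtain ⟨u, hu, hn⟩ := hf.exists_eq (π • v)
    have hv : f.toFun (π⁻¹ • u) = v := by rw [f.equivariant, hu, inv_smul_smul]
    have h1 := hf.ncard_le (π⁻¹ • u)
    have h2 := ncard_supp_eq f (π⁻¹ • u)
    have h3 := ncard_supp_eq f u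
    rw [ncard_supp_smul, hv] at h2
    rw [hu, ncard_supp_smul] at h3
    rw [hv] at h1
    omega
  have hN' : ∀ (π : FinPerm V) (v : Y), N (π • v) = N v := fun π v =>
    (hN π v).antisymm (by simpa using hN π⁻¹ (π • v))
  refine ⟨Quotient.lift (fun p : V × Y => N p.2 + 1) ?_, ⟨?_, ?_⟩, fun _ _ => rfl⟩
  · rintro ⟨x, v⟩ ⟨y, w⟩ ⟨z, -, h⟩
    change N v + 1 = N w + 1
    rw [← hN' (transp x z) v, ← hN' (transp y z) w]
    exact congrArg (N · + 1) h
  · rintro ⟨x, u⟩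
    refine (congrArg Set.ncard (boundVars_bindMap f x u)).trans_le ?_
    exact (Set.ncard_insert_le _ _).trans (Nat.add_le_add_right (hf.ncard_le u) 1)
  · rintro ⟨x, v⟩
    obtain ⟨u, hu, rfl, hd⟩ := hf.isSafeMap.exists_fresh v (Set.finite_singleton x)
    refine ⟨(x, u), rfl, ?_⟩
    refine (congrArg Set.ncard (boundVars_bindMap f x u)).trans ?_
    rw [Set.ncard_insert_of_notMem (by simpa using hd) (boundVars_finite _ _)]
    exact congrArg (· + 1) (le_antisymm (hf.ncard_le u) (hf.isSafeElement_iff.1 hu))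

theorem IsSafeMap.bindMap {f : X ⟶ Y} (hf : IsSafeMap f) : IsSafeMap (bindMap f) :=
  let ⟨_, hN⟩ := hf.exists_isGrading
  let ⟨_, hM, _⟩ := hN.exists_bindMap
  hM.isSafeMap

theorem isSafeElement_bindMap {f : X ⟶ Y} (hf : IsSafeMap f) {x : V} {u : X} :
    IsSafeElement (bindMap f) (x, u) ↔ IsSafeElement f u ∧ x ∉ boundVars f u := by
  obtain ⟨N, hN⟩ := hf.exists_isGrading
  obtain ⟨M, hM, hMN⟩ := hN.exists_bindMap
  refine hM.isSafeElement_iff.trans ?_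
  change M (bind x (f.toFun u)) ≤ _ ↔ _
  rw [hN.isSafeElement_iff, boundVars_bindMap, hMN]
  have h1 := hN.ncard_le u
  by_cases hx : x ∈ boundVars f u
  · rw [Set.insert_eq_of_mem hx]
    exact ⟨fun h => by omega, fun h => (h.2 hx).elim⟩
  · rw [Set.ncard_insert_of_notMem hx (boundVars_finite _ _)]
    simp [hx]

/-- The disjointness hypothesis includes `x ∉ supp v`, so `v` can be written with the same binder
`x`. Cancelling `x` reduces to the given square, where the lift is chosen not to bind `x`. -/
theorem IsSafeSquare.bindMap {p : Z ⟶ X} {f : X ⟶ W} {g : Z ⟶ Y} {r : Y ⟶ W}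
    (hf : IsSafeMap f) (hg : IsSafeMap g) (h : IsSafeSquare p f g r) :
    IsSafeSquare (namesProd.map p) (Nominal.bindMap f) (Nominal.bindMap g)
      (absFunctor.map r) := by
  refine ⟨hom_ext ?_, ?_⟩
  · rintro ⟨(x : V), z⟩
    exact congrArg (fun k : Z ⟶ W => bind x (k.toFun z)) h.1
  rintro ⟨(x : V), u⟩ hu v huv hd
  obtain ⟨hu, hx⟩ := (isSafeElement_bindMap hf).1 hu
  replace hd := hd.mono_left (boundVars_bindMap f x u).ge
  rw [Set.disjoint_insert_left] at hd
  obtain ⟨v, rfl⟩ := exists_eq_bind hd.1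
  have hd' := hd.2
  rw [supp_bind] at hd'
  obtain ⟨z, hz, rfl, rfl, k⟩ := h.exists_fresh hu (bind_injective (x := x) huv)
    (Set.disjoint_left.2 fun a ha hb => Set.disjoint_left.1 hd' ha
      ⟨hb, by rintro rfl; exact hx ha⟩) (Set.finite_singleton x)
  exact ⟨(x, z), (isSafeElement_bindMap hg).2 ⟨hz, fun hxz => hx (k x hxz rfl)⟩, rfl, rfl⟩

end Bind

end Closure

/-! ### Preservation of safety by the signature functors, and the limit -/

section Functors

variable {V : Type u} [DecidableEq V]

/-- The natural transformation `q : G ⟶ H` preserves safety if the passage from `f : X ⟶ Y` to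
`q_Y ∘ G f : G X ⟶ H Y` preserves safe maps and safe squares. -/
structure PreservesSafety {G H : Nom V ⥤ Nom V} (q : G ⟶ H) : Prop where
  map : ∀ {X Y : Nom V} {f : X ⟶ Y}, IsSafeMap f → IsSafeMap (G.map f ≫ q.app Y)
  square : ∀ {X Y Z W : Nom V} {p : Z ⟶ X} {f : X ⟶ W} {g : Z ⟶ Y} {r : Y ⟶ W},
    IsSafeMap f → IsSafeMap g → IsSafeSquare p f g r →
      IsSafeSquare (G.map p) (G.map f ≫ q.app W) (G.map g ≫ q.app Y) (H.map r)

theorem preservesSafety_id : PreservesSafety (𝟙 (𝟭 (Nom V))) where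
  map hf := hf
  square _ _ h := h

theorem preservesSafety_const (K : Nom V) : PreservesSafety (𝟙 (constFunctor K)) where
  map _ := isSafeMap_id K
  square _ _ _ := ⟨rfl, fun u hu _ huv _ => ⟨u, hu, rfl, huv⟩⟩

theorem hom_sum_ext {X Y Z : Nom V} {f g : sum X Y ⟶ Z}
    (h₁ : ∀ x, f.toFun (Sum.inl x : X ⊕ Y) = g.toFun (Sum.inl x : X ⊕ Y))
    (h₂ : ∀ y, f.toFun (Sum.inr y : X ⊕ Y) = g.toFun (Sum.inr y : X ⊕ Y)) : f = g :=
  hom_ext (by rintro (x | y); exacts [h₁ x, h₂ y])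

/-- Needed because case analysis on a sum is stuck on a variable; for products and dependent sums
the analogous identity is definitional by eta. -/
theorem map_comp_sumNat_app {G G' H H' : Nom V ⥤ Nom V} (q : G ⟶ G') (q' : H ⟶ H')
    {X Y : Nom V} (f : X ⟶ Y) :
    (sumFunctor G H).map f ≫ (sumNat q q').app Y =
      sumMap (G.map f ≫ q.app Y) (H.map f ≫ q'.app Y) :=
  hom_sum_ext (fun _ => rfl) fun _ => rfl

theorem PreservesSafety.sumNat {G G' H H' : Nom V ⥤ Nom V} {q : G ⟶ G'} {q' : H ⟶ H'}
    (h : PreservesSafety q) (h' : PreservesSafety q') : PreservesSafety (sumNat q q') where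
  map hf := by
    rw [map_comp_sumNat_app]
    exact (h.map hf).sumMap (h'.map hf)
  square hf hg hs := by
    rw [map_comp_sumNat_app, map_comp_sumNat_app]
    exact (h.square hf hg hs).sumMap (h'.square hf hg hs)

theorem PreservesSafety.sigmaNat {I : Type u} {G H : I → (Nom V ⥤ Nom V)} {q : ∀ i, G i ⟶ H i}
    (h : ∀ i, PreservesSafety (q i)) : PreservesSafety (sigmaNat q) where
  map hf := IsSafeMap.sigmaMap fun i => (h i).map hf
  square hf hg hs := IsSafeSquare.sigmaMap fun i => (h i).square hf hg hs

theorem PreservesSafety.isSafeMap_stageNat {G H : Nom V ⥤ Nom V} {q : G ⟶ H}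
    (h : PreservesSafety q) : ∀ n, IsSafeMap (stageNat q n)
  | 0 => isSafeMap_id _
  | n + 1 => h.map (h.isSafeMap_stageNat n)

theorem PreservesSafety.isSafeSquare_stageNat {G H : Nom V ⥤ Nom V} {q : G ⟶ H}
    (h : PreservesSafety q) : ∀ n, IsSafeSquare (stageMap G n) (stageNat q n) (stageNat q (n + 1))
      (stageMap H n)
  -- The upper and lower targets are both `1`, so any safe preimage of `v` closes the square.
  | 0 => ⟨rfl, fun _ _ v _ _ =>
      let ⟨z, hz, hv⟩ := h.isSafeMap_stageNat 1 v
      ⟨z, hz, rfl, hv⟩⟩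
  | n + 1 => h.square (h.isSafeMap_stageNat n) (h.isSafeMap_stageNat (n + 1))
      (h.isSafeSquare_stageNat n)

variable [Infinite V]

theorem preservesSafety_powNat : ∀ n : ℕ, PreservesSafety (powNat n : namesPow n ⟶ absPow (V := V) n)
  | 0 => preservesSafety_id
  | n + 1 =>
    { map := fun hf => ((preservesSafety_powNat n).map hf).bindMap
      square := fun hf hg h => IsSafeSquare.bindMap ((preservesSafety_powNat n).map hf)
        ((preservesSafety_powNat n).map hg) ((preservesSafety_powNat n).square hf hg h) }

theorem PreservesSafety.prodNat {G G' H H' : Nom V ⥤ Nom V} {q : G ⟶ G'} {q' : H ⟶ H'}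
    (h : PreservesSafety q) (h' : PreservesSafety q') : PreservesSafety (prodNat q q') where
  map hf := (h.map hf).prodMap (h'.map hf)
  square hf hg hs := IsSafeSquare.prodMap (h.map hf) (h'.map hf) (h.map hg) (h'.map hg)
    (h.square hf hg hs) (h'.square hf hg hs)

theorem PreservesSafety.listProdNat {G H : ℕ → (Nom V ⥤ Nom V)} {q : ∀ n, G n ⟶ H n}
    (h : ∀ n, PreservesSafety (q n)) : ∀ l : List ℕ, PreservesSafety (listProdNat q l)
  | [] => preservesSafety_const (one V)
  | n :: l => (h n).prodNat (PreservesSafety.listProdNat h l)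

theorem preservesSafety_quotNat (B : BindingSignature.{u}) : PreservesSafety (quotNat V B) :=
  (preservesSafety_const (names V)).sumNat <|
    .sigmaNat fun o => .listProdNat preservesSafety_powNat (B.ar o)

theorem PreservesSafety.exists_limNat_eq_toLim {G H : Nom V ⥤ Nom V} {q : G ⟶ H}
    (h : PreservesSafety q) (T : Endofunctor.Coalgebra H) (t : T.V) :
    ∃ s, limNat q s = toLim T t := by
  -- Disjointness is required from `supp t`, not from the support of the current approximant: the
  -- latter may grow with `n`, always within `supp t`.
  let P (n : ℕ) (u : stage G n) : Prop := IsSafeElement (stageNat q n) u ∧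
    (stageNat q n).toFun u = (cone T n).toFun t ∧ Disjoint (boundVars (stageNat q n) u) (supp t)
  have h0 : ∃ u, P 0 u :=
    let ⟨u, h1, h2, h3⟩ := (h.isSafeMap_stageNat 0).exists_fresh ((cone T 0).toFun t)
      (supp_finite t)
    ⟨u, h1, h2, h3⟩
  have hstep : ∀ n (u : {u // P n u}), ∃ z : {z // P (n + 1) z},
      (stageMap G n).toFun z.1 = u.1 := by
    rintro n ⟨u, hu, huv, hd⟩
    have hc := congrArg (fun k => k.toFun t) (cone_comm T n)
    simp only [comp_toFun] at hc
    -- Any bound variable of `z` in `supp t` is, by `k`, one of `u`, which `hd` excludes; so the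
    -- invariant passes to `z`.
    obtain ⟨z, hz, hzu, hzv, k⟩ := (h.isSafeSquare_stageNat n).exists_fresh hu (huv.trans hc.symm)
      (hd.mono_right (supp_map_subset (cone T (n + 1)) t)) (supp_finite t)
    exact ⟨⟨z, hz, hzv, Set.disjoint_left.2 fun a ha hb =>
      Set.disjoint_left.1 hd (k a ha hb) hb⟩, hzu⟩
  choose next hnext using hstep
  let s : ∀ n, {u // P n u} := fun n => Nat.rec ⟨h0.choose, h0.choose_spec⟩ next n
  exact ⟨⟨fun n => (s n).1, fun n => hnext n (s n)⟩, Subtype.ext (funext fun n => (s n).2.2.1)⟩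

end Functors

end Nominal

theorem mainTheorem4 (V : Type u) [DecidableEq V] [Countable V] [Infinite V]
    (B : Nominal.BindingSignature.{u}) :
    (∀ n : ℕ, Nominal.IsSafeMap (Nominal.stageNat (Nominal.quotNat V B) n)) ∧
    (∀ n : ℕ, Nominal.IsSafeSquare
      (Nominal.stageMap (Nominal.rawFunctor V B) n)
      (Nominal.stageNat (Nominal.quotNat V B) n)
      (Nominal.stageNat (Nominal.quotNat V B) (n + 1))
      (Nominal.stageMap (Nominal.alphaFunctor V B) n)) ∧
    (∀ T : Endofunctor.Coalgebra (Nominal.alphaFunctor V B), Limits.IsTerminal T →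
      Function.Surjective
        (Function.Pullback.snd :
          (Nominal.limNat (Nominal.quotNat V B)).Pullback (Nominal.toLim T) → T.V)) := by
  have h := Nominal.preservesSafety_quotNat (V := V) B
  refine ⟨h.isSafeMap_stageNat, h.isSafeSquare_stageNat, fun T _ t => ?_⟩
  obtain ⟨s, hs⟩ := h.exists_limNat_eq_toLim T t
  exact ⟨⟨(s, t), hs⟩, rfl⟩
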